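/- **System.** Let $U$ be a finite set of inputs and let $T(B\mid x,u)=\sum_{r=1}^K\alpha_r(x,u)\int_B\mathcal N(y\mid\mu^r(x,u),\Sigma^r(x,u))\,dy$ be the one-step kernel of a controlled stochastic system on $\mathbb R^n$, where $\alpha_r\ge 0$, $\sum_r\alpha_r=1$, each $\Sigma^r(x,u)$ is diagonal and positive definite, and $\alpha_r,\mu^r,\Sigma^r$ are continuous in $x$. For a measurable policy $\pi_x:\mathbb R^n\times\mathbb N_0\to U$ and $x_0\in\mathbb R^n$ let $P^{x_0,\pi_x}$ be the law of the Markov process started at $x_0$ with transition kernel $T(\cdot\mid x,\pi_x(x,k))$ at time $k$. Let $X=\prod_i[\underline x_i,\overline x_i]$, let $R,O\subseteq X$ be closed with $R\cap O=\emptyset$, let $H\in\mathbb N_0$, and put $$P_{\mathrm{ra}}(R,O,x_0,\pi_x,H)=P^{x_0,\pi_x}\big[\exists k\le H:\ x_k\in R,\ \forall k'\le k:\ x_{k'}\notin O,\ x_{k'}\in X\big].$$ **Abstract states.** Partition each $[\underline x_i,\overline x_i]$ into finitely many nonempty intervals, called cells, with end points $\underline t_i\le\overline t_i$ (each end point may or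 may not belong to the cell). Let $S_i$ consist of these cells and a sink state $\breve s^i$ representing $\mathbb R\setminus[\underline x_i,\overline x_i]$, let $S=\prod_iS_i$, and let $J:\mathbb R^n\to S$ map $x$ to the unique $s\in S$ whose region contains $x$. The abstract reach states are the states without sink component whose region is contained in $R$. The abstract avoid states are those whose region meets $O$, and all states with a sink component. **odIMDP abstraction.** An interval ambiguity set over a finite set $F$ is $\{\gamma \text{ a probability distribution on } F:\underline p\le\gamma\le\overline p\}$ with $0\le\underline p\le\overline p\le1$ and $\sum\underline p\le1\le\sum\overline p$. An odIMDP on $S$ with actions $U$ assigns to each $(s,a,i)$ an interval ambiguity set $\Gamma^i_{s,a}$ over $S_i$, with bounds $\underline p^i_{s,a},\overline p^i_{s,a}$; its ambiguity sets are $\Gamma_{s,a}=\{\prod_i\gamma^i(t^i):\gamma^i\in\Gamma^i_{s,a}\}$. It is an abstraction of a normal kernel with mean $\mu$ and diagonal covariance $\Sigma$ if the following holds. For all states $s$ without sink component, actions $a$ and axes $i$ there are intervals $[\underline\mu,\overline\mu]\subset\mathbb R$ and $[\underline\Sigma,\overline\Sigma]\subset(0,\infty)$ containing $\mu(x,a)_i$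 and $\Sigma(x,a)_{ii}$, respectively, for every $x$ in the region of $s$, such that, for each cell $t^i$, $\underline p^i_{s,a}(t^i)$ and $\overline p^i_{s,a}(t^i)$ are the minimum and the maximum of $\int_{\underline t_i}^{\overline t_i}\mathcal N(y\mid m,v)\,dy$ over $(m,v)\in[\underline\mu,\overline\mu]\times[\underline\Sigma,\overline\Sigma]$, and $\underline p^i_{s,a}(\breve s^i)$ and $\overline p^i_{s,a}(\breve s^i)$ are $1$ minus the maximum and $1$ minus the minimum of $\int_{\underline x_i}^{\overline x_i}\mathcal N(y\mid m,v)\,dy$ over the same set. Whenever $s^i=\breve s^i$, $\underline p^i_{s,a}=\overline p^i_{s,a}$ is the indicator of $\breve s^i$. **Mixture abstraction.** For a mixture of $K$ Gaussians, an abstraction consists of one such odIMDP abstraction for each component $r$, with ambiguity sets $\Gamma_{r,s,a}$, together with interval ambiguity sets $\Gamma^\alpha_{s,a}$ over $\{1,\dots,K\}$ such that $(\alpha_r(x,a))_r\in\Gamma^\alpha_{s,a}$ for each $x$ in the region of a state $s$ without sink component; its ambiguity sets are $\Gamma_{s,a}=\{\sum_r\alpha(r)\gamma^r:\alpha\in\Gamma^\alpha_{s,a},\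 \gamma^r\in\Gamma_{r,s,a}\}$. **Values.** For a strategy $\pi:S\times\mathbb N_0\to U$ and horizon $H$, let $V^\pi_H$ be the last term of the recursion $V_0=\mathbf 1_R$, $$V_k(s)=\mathbf 1_R(s)+\mathbf 1_{S\setminus(R\cup O)}(s)\,\min_{\gamma\in\Gamma_{s,a}}\sum_{t\in S}V_{k-1}(t)\gamma(t),\qquad a=\pi(s,H-k),\quad k=1,\dots,H,$$ where $R,O$ here denote the abstract reach and avoid states, and let $\hat V^\pi_H$ be the same with $\max$ in place of $\min$. Let $W^\pi_H$ and $\hat W^\pi_H$ be obtained in the same way with the divide-and-conquer backup, which optimizes the marginals one after another: for $\min$ it is $\min_{\gamma^1\in\Gamma^1_{s,a}}\sum_{t^1}\gamma^1(t^1)\cdots\min_{\gamma^n\in\Gamma^n_{s,a}}\sum_{t^n}\gamma^n(t^n)V_{k-1}(t)$, and for mixtures the minimum over $\alpha\in\Gamma^\alpha_{s,a}$ of the $\alpha$-weighted sum of these expressions over the components; likewise for $\max$. **Theorem.** Let $M$ be an odIMDP abstraction of a Gaussian system ($K=1$), or a mixture-of-odIMDPs abstraction of a Gaussian mixture system. For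 every strategy $\pi$, every $x_0\in X$ and every $H\in\mathbb N_0$, the controller $\pi_x(x,k)=\pi(J(x),k)$ satisfies $$P_{\mathrm{ra}}(R,O,x_0,\pi_x,H)\ \ge\ V^\pi_H(J(x_0)).$$ If moreover $R$ and $O$ are unions of regions of grid cells, then $$P_{\mathrm{ra}}(R,O,x_0,\pi_x,H)\in\big[V^\pi_H(J(x_0)),\hat V^\pi_H(J(x_0))\big].$$ The same holds with $W^\pi_H,\hat W^\pi_H$ in place of $V^\pi_H,\hat V^\pi_H$. -/

import Mathlib

open MeasureTheory ProbabilityTheory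

namespace OdIMDP

noncomputable section

/-! ## The concrete stochastic system -/

/-- Probability density at `y` of the `n`-dimensional normal distribution with mean `m` and
covariance matrix `S`. -/
def gaussianDensity {n : ℕ} (m : Fin n → ℝ) (S : Matrix (Fin n) (Fin n) ℝ) (y : Fin n → ℝ) : ℝ :=
  (Real.sqrt ((2 * Real.pi) ^ n * S.det))⁻¹ *
    Real.exp (-(1 / 2) * ((y - m) ⬝ᵥ (S⁻¹.mulVec (y - m))))

/-- The normal distribution `B ↦ ∫_B N(y ∣ m, S) dy` on `ℝⁿ`. -/
def gaussianMeasure {n : ℕ} (m : Fin n → ℝ) (S : Matrix (Fin n) (Fin n) ℝ) :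
    Measure (Fin n → ℝ) :=
  volume.withDensity fun y => ENNReal.ofReal (gaussianDensity m S y)

/-- The one-step kernel data of a controlled system on `ℝⁿ` with input set `U`: a mixture of `K`
normal distributions with diagonal positive definite covariance, whose weights, means and
covariances depend continuously on the state. -/
structure System (n K : ℕ) (U : Type*) where
  weight : Fin K → (Fin n → ℝ) → U → ℝ
  mean : Fin K → (Fin n → ℝ) → U → (Fin n → ℝ)
  cov : Fin K → (Fin n → ℝ) → U → Matrix (Fin n) (Fin n) ℝ
  weight_nonneg : ∀ r x u, 0 ≤ weight r x u
  weight_sum : ∀ x u, ∑ r, weight r x u = 1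
  cov_posDef : ∀ r x u, (cov r x u).PosDef
  cov_isDiag : ∀ r x u, (cov r x u).IsDiag
  weight_continuous : ∀ r u, Continuous fun x => weight r x u
  mean_continuous : ∀ r u, Continuous fun x => mean r x u
  cov_continuous : ∀ r u, Continuous fun x => cov r x u

/-- A (measurable, time-dependent, Markov) control policy of the concrete system. -/
structure Policy (n : ℕ) (U : Type*) where
  act : (Fin n → ℝ) → ℕ → U
  measurableSet_act : ∀ k u, MeasurableSet {x | act x k = u}

theorem gaussianDensity_eq_prod {n : ℕ} (m : Fin n → ℝ) {S : Matrix (Fin n) (Fin n) ℝ}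
    (hS : S.PosDef) (hd : S.IsDiag) (y : Fin n → ℝ) :
    gaussianDensity m S y = ∏ i, gaussianPDFReal (m i) (S i i).toNNReal (y i) := by
  have hpos : ∀ i, 0 < S i i := fun i => hS.diag_pos
  have hS' : S = Matrix.diagonal (fun i => S i i) := hd.diagonal_diag.symm
  have hinv : S⁻¹ = Matrix.diagonal (fun i => (S i i)⁻¹) := by
    apply Matrix.inv_eq_right_inv
    conv_lhs => rw [hS']
    rw [Matrix.diagonal_mul_diagonal, ← Matrix.diagonal_one]
    congr 1
    ext i
    simp [(hpos i).ne']
  have hdet : S.det = ∏ i, S i i := by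
    conv_lhs => rw [hS']
    rw [Matrix.det_diagonal]
  have hsq : Real.sqrt ((2 * Real.pi) ^ n * S.det)
      = ∏ i, Real.sqrt (2 * Real.pi * S i i) := by
    rw [hdet, ← Real.sqrt_prod]
    · congr 1
      rw [Finset.prod_mul_distrib]
      simp
    · intro i _
      have := hpos i
      positivity
  unfold gaussianDensity gaussianPDFReal
  rw [hsq, hinv, Finset.prod_mul_distrib, ← Real.exp_sum, Finset.prod_inv_distrib]
  congr 1
  · congr 1
    refine Finset.prod_congr rfl fun i _ => ?_
    rw [Real.coe_toNNReal _ (hpos i).le]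
  · congr 1
    simp only [dotProduct, Matrix.mulVec_diagonal, Finset.mul_sum, Pi.sub_apply]
    refine Finset.sum_congr rfl fun i _ => ?_
    rw [Real.coe_toNNReal _ (hpos i).le]
    have := (hpos i).ne'
    field_simp

theorem gaussianMeasure_univ {n : ℕ} (m : Fin n → ℝ) {S : Matrix (Fin n) (Fin n) ℝ}
    (hS : S.PosDef) (hd : S.IsDiag) : gaussianMeasure m S Set.univ = 1 := by
  have hpos : ∀ i, (S i i).toNNReal ≠ 0 := fun i => by
    simpa using (hS.diag_pos (i := i))
  have hint : Integrable
      (fun y : Fin n → ℝ => ∏ i, gaussianPDFReal (m i) (S i i).toNNReal (y i)) :=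
    Integrable.fintype_prod fun i => integrable_gaussianPDFReal _ _
  unfold gaussianMeasure
  simp only [gaussianDensity_eq_prod m hS hd]
  rw [withDensity_apply _ MeasurableSet.univ, Measure.restrict_univ,
    ← ofReal_integral_eq_lintegral_ofReal hint
      (Filter.Eventually.of_forall fun y =>
        Finset.prod_nonneg fun i _ => gaussianPDFReal_nonneg _ _ _),
    integral_fintype_prod_volume_eq_prod]
  simp [integral_gaussianPDFReal_eq_one _ (hpos _)]

namespace System

variable {n K : ℕ} {U : Type*}

/-- The one-step transition kernel `T(· ∣ x, u)`. -/
def transition (T : System n K U) (x : Fin n → ℝ) (u : U) : Measure (Fin n → ℝ) :=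
  ∑ r, ENNReal.ofReal (T.weight r x u) • gaussianMeasure (T.mean r x u) (T.cov r x u)

theorem transition_univ (T : System n K U) (x : Fin n → ℝ) (u : U) :
    T.transition x u Set.univ = 1 := by
  simp only [transition, Measure.coe_finsetSum, Finset.sum_apply, Measure.smul_apply,
    gaussianMeasure_univ _ (T.cov_posDef _ x u) (T.cov_isDiag _ x u), smul_eq_mul, mul_one]
  rw [← ENNReal.ofReal_sum_of_nonneg fun r _ => T.weight_nonneg r x u, T.weight_sum,
    ENNReal.ofReal_one]

theorem measurable_transition (T : System n K U) (u : U) :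
    Measurable fun x => T.transition x u := by
  refine Measure.measurable_of_measurable_coe _ fun B hB => ?_
  simp only [transition, Measure.coe_finsetSum, Finset.sum_apply, Measure.smul_apply,
    smul_eq_mul]
  refine Finset.measurable_sum _ fun r _ => Measurable.mul ?_ ?_
  · exact (T.weight_continuous r u).measurable.ennreal_ofReal
  · simp only [gaussianMeasure, withDensity_apply _ hB,
      gaussianDensity_eq_prod _ (T.cov_posDef r _ u) (T.cov_isDiag r _ u)]
    refine Measurable.lintegral_prod_right' (f := fun p : (Fin n → ℝ) × (Fin n → ℝ) =>
      ENNReal.ofReal (∏ i, gaussianPDFReal (T.mean r p.1 u i)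
        (T.cov r p.1 u i i).toNNReal (p.2 i))) ?_
    refine Measurable.ennreal_ofReal (Finset.measurable_prod _ fun i _ => ?_)
    have h1 : Measurable fun p : (Fin n → ℝ) × (Fin n → ℝ) => T.mean r p.1 u i :=
      (((continuous_apply i).comp (T.mean_continuous r u)).comp continuous_fst).measurable
    have h2 : Measurable fun p : (Fin n → ℝ) × (Fin n → ℝ) =>
        (((T.cov r p.1 u i i).toNNReal : NNReal) : ℝ) := by
      have : Continuous fun x => T.cov r x u i i := (T.cov_continuous r u).matrix_elem i i
      exact ((this.comp continuous_fst).measurable.real_toNNReal).coe_nnreal_real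
    have h3 : Measurable fun p : (Fin n → ℝ) × (Fin n → ℝ) => p.2 i :=
      ((continuous_apply i).comp continuous_snd).measurable
    simp only [gaussianPDFReal]
    fun_prop

/-- The closed-loop transition kernel `T(· ∣ x, π(x, k))` at time `k`. -/
def closedLoop [Finite U] (T : System n K U) (π : Policy n U) (k : ℕ) :
    Kernel (Fin n → ℝ) (Fin n → ℝ) where
  toFun x := T.transition x (π.act x k)
  measurable' := by
    intro C hC
    have : (fun x => T.transition x (π.act x k)) ⁻¹' C
        = ⋃ u, {x | π.act x k = u} ∩ (fun x => T.transition x u) ⁻¹' C := by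
      ext x
      simp
    rw [this]
    exact MeasurableSet.iUnion fun u =>
      (π.measurableSet_act k u).inter (T.measurable_transition u hC)

instance [Finite U] (T : System n K U) (π : Policy n U) (k : ℕ) :
    IsMarkovKernel (T.closedLoop π k) :=
  ⟨fun x => ⟨T.transition_univ x (π.act x k)⟩⟩

/-- The law of the trajectory `(x₀, x₁, …)` started at `x₀` and controlled by `π`: the
Ionescu-Tulcea measure of the kernels `T(· ∣ x_k, π(x_k, k))`. -/
def pathMeasure [Finite U] (T : System n K U) (π : Policy n U) (x₀ : Fin n → ℝ) :
    Measure (ℕ → Fin n → ℝ) :=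
  Kernel.traj (X := fun _ => Fin n → ℝ)
    (fun k => (T.closedLoop π k).comap
      (fun h : (i : Finset.Iic k) → (Fin n → ℝ) => h ⟨k, Finset.mem_Iic.2 le_rfl⟩)
      (measurable_pi_apply _)) 0 (fun _ => x₀)

/-- The probabilistic reach-avoid value `P_ra(R, O, x₀, π, H)` relative to the region of
interest `X`. -/
def reachAvoidProb [Finite U] (T : System n K U) (X R O : Set (Fin n → ℝ)) (x₀ : Fin n → ℝ)
    (π : Policy n U) (H : ℕ) : ℝ :=
  (T.pathMeasure π x₀).real
    {ω | ∃ k ≤ H, ω k ∈ R ∧ ∀ k' ≤ k, ω k' ∉ O ∧ ω k' ∈ X}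

end System

/-! ## Ambiguity sets, odIMDPs and mixtures of odIMDPs -/

/-- Interval bounds `lower ≤ upper` for probability distributions over a finite set. -/
structure IntervalBounds (S : Type*) [Fintype S] where
  lower : S → ℝ
  upper : S → ℝ
  lower_nonneg : ∀ s, 0 ≤ lower s
  lower_le_upper : ∀ s, lower s ≤ upper s
  upper_le_one : ∀ s, upper s ≤ 1
  sum_lower_le_one : ∑ s, lower s ≤ 1
  one_le_sum_upper : 1 ≤ ∑ s, upper s

/-- The interval ambiguity set given by interval bounds. -/
def IntervalBounds.set {S : Type*} [Fintype S] (b : IntervalBounds S) : Set (S → ℝ) :=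
  {γ | γ ∈ stdSimplex ℝ S ∧ ∀ s, b.lower s ≤ γ s ∧ γ s ≤ b.upper s}

/-- An orthogonally decoupled IMDP with `n` marginals, joint states `∀ i, S i` and actions `A`:
one interval ambiguity set for each source state, action and marginal. -/
structure ODIMDP {n : ℕ} (S : Fin n → Type*) [∀ i, Fintype (S i)] (A : Type*) where
  bounds : (∀ i, S i) → A → ∀ i, IntervalBounds (S i)

/-- A mixture of `K` odIMDPs with the same states and actions, with interval ambiguity sets for
the weights of the mixture. -/
structure MixtureODIMDP (K : ℕ) {n : ℕ} (S : Fin n → Type*) [∀ i, Fintype (S i)] (A : Type*) where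
  component : Fin K → ODIMDP S A
  weightBounds : (∀ i, S i) → A → IntervalBounds (Fin K)

/-! ## Value iteration -/

/-- `min_{γ ∈ Γ} ∑ t, V t * γ t`. -/
def minExp {S : Type*} [Fintype S] (Γ : Set (S → ℝ)) (V : S → ℝ) : ℝ :=
  sInf ((fun γ => ∑ t, V t * γ t) '' Γ)

/-- `max_{γ ∈ Γ} ∑ t, V t * γ t`. -/
def maxExp {S : Type*} [Fintype S] (Γ : Set (S → ℝ)) (V : S → ℝ) : ℝ :=
  sSup ((fun γ => ∑ t, V t * γ t) '' Γ)

/-- Optimization of one marginal after another: with `W⁽ⁿ⁾ = V` and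
`W⁽ⁱ⁻¹⁾(t) = opt i (fun u ↦ W⁽ⁱ⁾(t with i-th coordinate u))`, this is `W⁽⁰⁾` (it does not depend
on the remaining argument). -/
def sequentialOpt {n : ℕ} {S : Fin n → Type*} (opt : ∀ i, (S i → ℝ) → ℝ)
    (V : (∀ i, S i) → ℝ) : (∀ i, S i) → ℝ :=
  (List.finRange n).foldr
    (fun i W t => opt i fun u => W (Function.update t i u)) V

/-- Value iteration for a reach-avoid objective under a given strategy, with Bellman backup
`B s a V`. `valueIteration R O B k π s` is the value of following `π` from time `0` for `k` steps
from `s`; after the first step the strategy is `(t, j) ↦ π t (j + 1)`. -/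
def valueIteration {S A : Type*} (reach avoid : Set S) (B : S → A → (S → ℝ) → ℝ) :
    ℕ → (S → ℕ → A) → S → ℝ
  | 0, _, s => reach.indicator 1 s
  | k + 1, π, s => reach.indicator 1 s + (reach ∪ avoid)ᶜ.indicator 1 s *
      B s (π s 0) (valueIteration reach avoid B k fun t j => π t (j + 1))

namespace ODIMDP

variable {n : ℕ} {S : Fin n → Type*} [∀ i, Fintype (S i)] {A : Type*}

/-- The product ambiguity set `Γ_{s,a} = ⨂ᵢ Γⁱ_{s,a}`. -/
def ambiguity (M : ODIMDP S A) (s : ∀ i, S i) (a : A) : Set ((∀ i, S i) → ℝ) :=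
  {γ | γ ∈ stdSimplex ℝ (∀ i, S i) ∧
    ∃ γm : ∀ i, S i → ℝ, (∀ i, γm i ∈ (M.bounds s a i).set) ∧ ∀ t, γ t = ∏ i, γm i (t i)}

/-- The pessimistic divide-and-conquer backup `W_{s,a}`. -/
def seqMin (M : ODIMDP S A) (s : ∀ i, S i) (a : A) (V : (∀ i, S i) → ℝ) : ℝ :=
  sequentialOpt (fun i => minExp (M.bounds s a i).set) V s

/-- The optimistic divide-and-conquer backup. -/
def seqMax (M : ODIMDP S A) (s : ∀ i, S i) (a : A) (V : (∀ i, S i) → ℝ) : ℝ :=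
  sequentialOpt (fun i => maxExp (M.bounds s a i).set) V s

/-- The pessimistic value `V^π_H(s)`. -/
def lowerValue (M : ODIMDP S A) (reach avoid : Set (∀ i, S i)) (π : (∀ i, S i) → ℕ → A)
    (H : ℕ) (s : ∀ i, S i) : ℝ :=
  valueIteration reach avoid (fun s a => minExp (M.ambiguity s a)) H π s

/-- The optimistic value `V̂^π_H(s)`. -/
def upperValue (M : ODIMDP S A) (reach avoid : Set (∀ i, S i)) (π : (∀ i, S i) → ℕ → A)
    (H : ℕ) (s : ∀ i, S i) : ℝ :=
  valueIteration reach avoid (fun s a => maxExp (M.ambiguity s a)) H π s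

/-- The pessimistic value computed with the divide-and-conquer backup. -/
def lowerValueDC (M : ODIMDP S A) (reach avoid : Set (∀ i, S i)) (π : (∀ i, S i) → ℕ → A)
    (H : ℕ) (s : ∀ i, S i) : ℝ :=
  valueIteration reach avoid M.seqMin H π s

/-- The optimistic value computed with the divide-and-conquer backup. -/
def upperValueDC (M : ODIMDP S A) (reach avoid : Set (∀ i, S i)) (π : (∀ i, S i) → ℕ → A)
    (H : ℕ) (s : ∀ i, S i) : ℝ :=
  valueIteration reach avoid M.seqMax H π s

end ODIMDP

namespace MixtureODIMDP

variable {K n : ℕ} {S : Fin n → Type*} [∀ i, Fintype (S i)] {A : Type*}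

/-- The feasible distributions `∑ r, α r * γʳ`, with `α` in the weight ambiguity set and `γʳ` in
the product ambiguity set of component `r`. -/
def ambiguity (M : MixtureODIMDP K S A) (s : ∀ i, S i) (a : A) : Set ((∀ i, S i) → ℝ) :=
  {γ | ∃ α ∈ (M.weightBounds s a).set, ∃ γc : Fin K → (∀ i, S i) → ℝ,
    (∀ r, γc r ∈ (M.component r).ambiguity s a) ∧ ∀ t, γ t = ∑ r, α r * γc r t}

/-- The pessimistic value `V^π_H(s)`. -/
def lowerValue (M : MixtureODIMDP K S A) (reach avoid : Set (∀ i, S i))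
    (π : (∀ i, S i) → ℕ → A) (H : ℕ) (s : ∀ i, S i) : ℝ :=
  valueIteration reach avoid (fun s a => minExp (M.ambiguity s a)) H π s

/-- The optimistic value `V̂^π_H(s)`. -/
def upperValue (M : MixtureODIMDP K S A) (reach avoid : Set (∀ i, S i))
    (π : (∀ i, S i) → ℕ → A) (H : ℕ) (s : ∀ i, S i) : ℝ :=
  valueIteration reach avoid (fun s a => maxExp (M.ambiguity s a)) H π s

/-- The pessimistic value with the backup `min_{α ∈ Γ^α} ∑ r, α r * W_{r,s,a}`. -/
def lowerValueDC (M : MixtureODIMDP K S A) (reach avoid : Set (∀ i, S i))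
    (π : (∀ i, S i) → ℕ → A) (H : ℕ) (s : ∀ i, S i) : ℝ :=
  valueIteration reach avoid
    (fun s a V => minExp (M.weightBounds s a).set fun r => (M.component r).seqMin s a V) H π s

/-- The optimistic value with the backup `max_{α ∈ Γ^α} ∑ r, α r * W_{r,s,a}`. -/
def upperValueDC (M : MixtureODIMDP K S A) (reach avoid : Set (∀ i, S i))
    (π : (∀ i, S i) → ℕ → A) (H : ℕ) (s : ∀ i, S i) : ℝ :=
  valueIteration reach avoid
    (fun s a V => maxExp (M.weightBounds s a).set fun r => (M.component r).seqMax s a V) H π s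

end MixtureODIMDP

/-! ## The grid and the abstraction -/

/-- A grid on the hyperrectangle `X = ∏ᵢ [lo i, up i]`: along each axis `i` the interval
`[lo i, up i]` is partitioned into `N i` nonempty intervals `cell i c` with end points
`left i c` and `right i c` (each end point may or may not belong to the cell). -/
structure Grid (n : ℕ) where
  lo : Fin n → ℝ
  up : Fin n → ℝ
  N : Fin n → ℕ
  left : ∀ i, Fin (N i) → ℝ
  right : ∀ i, Fin (N i) → ℝ
  cell : ∀ i, Fin (N i) → Set ℝ
  cell_nonempty : ∀ i c, (cell i c).Nonempty
  Ioo_subset_cell : ∀ i c, Set.Ioo (left i c) (right i c) ⊆ cell i c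
  cell_subset_Icc : ∀ i c, cell i c ⊆ Set.Icc (left i c) (right i c)
  cell_disjoint : ∀ i c d, c ≠ d → Disjoint (cell i c) (cell i d)
  iUnion_cell : ∀ i, ⋃ c, cell i c = Set.Icc (lo i) (up i)

namespace Grid

variable {n : ℕ}

/-- The region of interest `X`. -/
def domain (G : Grid n) : Set (Fin n → ℝ) :=
  {x | ∀ i, x i ∈ Set.Icc (G.lo i) (G.up i)}

/-- Abstract states of axis `i`: the cells, and the sink state `none`. -/
abbrev AxisState (G : Grid n) (i : Fin n) : Type := Option (Fin (G.N i))

/-- Joint abstract states. -/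
abbrev State (G : Grid n) : Type := ∀ i, G.AxisState i

/-- The joint abstract state of a grid cell (no sink component). -/
def cellState (G : Grid n) (c : ∀ i, Fin (G.N i)) : G.State := fun i => some (c i)

/-- The part of the `i`-th axis represented by an abstract state of that axis; the sink state
represents the complement of `[lo i, up i]`. -/
def axisRegion (G : Grid n) (i : Fin n) : G.AxisState i → Set ℝ
  | none => (Set.Icc (G.lo i) (G.up i))ᶜ
  | some c => G.cell i c

/-- The region of `ℝⁿ` represented by a joint abstract state. -/
def region (G : Grid n) (s : G.State) : Set (Fin n → ℝ) :=
  {x | ∀ i, x i ∈ G.axisRegion i (s i)}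

theorem exists_unique_axisState (G : Grid n) (i : Fin n) (y : ℝ) :
    ∃! s : G.AxisState i, y ∈ G.axisRegion i s := by
  by_cases h : y ∈ Set.Icc (G.lo i) (G.up i)
  · have h' := h
    rw [← G.iUnion_cell i, Set.mem_iUnion] at h'
    obtain ⟨c, hc⟩ := h'
    refine ⟨some c, hc, ?_⟩
    rintro (_ | d) hd
    · exact absurd h hd
    · by_contra hne
      exact Set.disjoint_left.1 (G.cell_disjoint i d c fun e => hne (congrArg some e)) hd hc
  · refine ⟨none, h, ?_⟩
    rintro (_ | d) hd
    · rfl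
    · exact absurd (G.iUnion_cell i ▸ Set.mem_iUnion.2 ⟨d, hd⟩) h

/-- The map `J` sending a concrete state to its abstract state. -/
def J (G : Grid n) (x : Fin n → ℝ) : G.State :=
  fun i => (G.exists_unique_axisState i (x i)).choose

theorem J_eq_iff (G : Grid n) (x : Fin n → ℝ) (s : G.State) : G.J x = s ↔ x ∈ G.region s := by
  constructor
  · rintro rfl i
    exact (G.exists_unique_axisState i (x i)).choose_spec.1
  · intro h
    funext i
    exact ((G.exists_unique_axisState i (x i)).choose_spec.2 (s i) (h i)).symm

theorem measurableSet_region (G : Grid n) (s : G.State) : MeasurableSet (G.region s) := by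
  have hcell : ∀ i c, MeasurableSet (G.cell i c) := by
    intro i c
    apply Set.OrdConnected.measurableSet
    refine ⟨fun a ha b hb y hy => ?_⟩
    rcases eq_or_lt_of_le hy.1 with e | h1
    · exact e ▸ ha
    rcases eq_or_lt_of_le hy.2 with e | h2
    · exact e ▸ hb
    exact G.Ioo_subset_cell i c ⟨(G.cell_subset_Icc i c ha).1.trans_lt h1,
      h2.trans_le (G.cell_subset_Icc i c hb).2⟩
  have : G.region s = ⋂ i, (fun x : Fin n → ℝ => x i) ⁻¹' G.axisRegion i (s i) := by
    ext x
    simp [region]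
  rw [this]
  refine MeasurableSet.iInter fun i => measurable_pi_apply i ?_
  cases h : s i with
  | none => exact measurableSet_Icc.compl
  | some c => exact hcell i c

/-- The switching controller `π_x(x, k) = π(J(x), k)` induced by an abstract strategy `π`. -/
def inducedPolicy {U : Type*} (G : Grid n) (π : G.State → ℕ → U) : Policy n U where
  act x k := π (G.J x) k
  measurableSet_act k u := by
    have : {x | π (G.J x) k = u} = ⋃ s ∈ {s : G.State | π s k = u}, G.region s := by
      ext x
      simp [← G.J_eq_iff]
    rw [this]
    exact MeasurableSet.biUnion (Set.to_countable _) fun s _ => G.measurableSet_region s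

/-- Abstract reach states: grid cells contained in `R`. -/
def reachStates (G : Grid n) (R : Set (Fin n → ℝ)) : Set G.State :=
  {s | (∀ i, s i ≠ none) ∧ G.region s ⊆ R}

/-- Abstract avoid states: grid cells that meet `O`, and all sink states. -/
def avoidStates (G : Grid n) (O : Set (Fin n → ℝ)) : Set G.State :=
  {s | (∃ i, s i = none) ∨ (G.region s ∩ O).Nonempty}

/-- A subset of `X` is aligned with the grid if it is a union of grid cells. -/
def Aligned (G : Grid n) (B : Set (Fin n → ℝ)) : Prop :=
  ∃ C : Set (∀ i, Fin (G.N i)), B = ⋃ c ∈ C, G.region (G.cellState c)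

end Grid

/-- The probabilities that a one-dimensional normal distribution with mean in `[mlo, mup]` and
variance in `[vlo, vup]` assigns to the interval `[a, b]`. -/
def intervalProbs (mlo mup vlo vup a b : ℝ) : Set ℝ :=
  {p | ∃ m ∈ Set.Icc mlo mup, ∃ v ∈ Set.Icc vlo vup,
    p = (gaussianReal m v.toNNReal).real (Set.Icc a b)}

/-- `M` is the odIMDP abstraction, over the grid `G`, of the normal transition kernel with mean
`mean x a` and diagonal covariance `cov x a`. For each grid cell, action and axis there are interval
bounds of the mean and of the variance over the cell, and the bounds of the marginal ambiguity set
are the extreme interval probabilities of normal distributions within them. The bounds of the sink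
are obtained from the complement, and a sink component of a state is absorbing. -/
structure IsGaussianAbstraction {n : ℕ} {U : Type*} (G : Grid n)
    (mean : (Fin n → ℝ) → U → (Fin n → ℝ))
    (cov : (Fin n → ℝ) → U → Matrix (Fin n) (Fin n) ℝ) (M : ODIMDP G.AxisState U) : Prop where
  cell_bounds : ∀ (c : ∀ i, Fin (G.N i)) (a : U) (i : Fin n), ∃ mlo mup vlo vup : ℝ,
    0 < vlo ∧
    (∀ x ∈ G.region (G.cellState c),
      mean x a i ∈ Set.Icc mlo mup ∧ cov x a i i ∈ Set.Icc vlo vup) ∧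
    (∀ t : Fin (G.N i),
      IsLeast (intervalProbs mlo mup vlo vup (G.left i t) (G.right i t))
        ((M.bounds (G.cellState c) a i).lower (some t)) ∧
      IsGreatest (intervalProbs mlo mup vlo vup (G.left i t) (G.right i t))
        ((M.bounds (G.cellState c) a i).upper (some t))) ∧
    IsGreatest (intervalProbs mlo mup vlo vup (G.lo i) (G.up i))
      (1 - (M.bounds (G.cellState c) a i).lower none) ∧
    IsLeast (intervalProbs mlo mup vlo vup (G.lo i) (G.up i))
      (1 - (M.bounds (G.cellState c) a i).upper none)
  sink_absorbing : ∀ (s : G.State) (a : U) (i : Fin n), s i = none →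
    (M.bounds s a i).lower none = 1 ∧ (M.bounds s a i).upper none = 1 ∧
    ∀ t : Fin (G.N i), (M.bounds s a i).lower (some t) = 0 ∧ (M.bounds s a i).upper (some t) = 0

/-- `M` is the mixture-of-odIMDPs abstraction of the system `T` over the grid `G`: each component
abstracts the corresponding normal distribution, and over each grid cell the weight ambiguity set
contains the weights of the system. -/
structure IsMixtureAbstraction {n K : ℕ} {U : Type*} (G : Grid n) (T : System n K U)
    (M : MixtureODIMDP K G.AxisState U) : Prop where
  component : ∀ r, IsGaussianAbstraction G (T.mean r) (T.cov r) (M.component r)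
  weights : ∀ (c : ∀ i, Fin (G.N i)) (a : U), ∀ x ∈ G.region (G.cellState c),
    (fun r => T.weight r x a) ∈ (M.weightBounds (G.cellState c) a).set

end

end OdIMDP

/-!
Value iteration on the abstraction brackets the reach-avoid probability of the concrete system
because both are computed by backward recursions, and the two recursions compare step by step.

*Concrete side.* The closed loop is a time-inhomogeneous Markov chain. By the Markov property of
the Ionescu-Tulcea measure, the conditional probability of the remaining reach-avoid event, given
any history, depends only on the current state and satisfies the dynamic programming recursion
`reachAvoidValue` (`traj_reachAvoidEvent`): the value is `1` on `R`, it is `0` outside `X \ O`, and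
elsewhere it is the expectation of the next value under the one-step kernel.

*Abstract side.* Let `x` lie in a grid cell `s`. The map `J` pushes the one-step distribution at `x`
forward to a distribution on abstract states. As the covariances are diagonal, each normal
component is a product of one-dimensional normal distributions (`gaussianMeasure_eq_pi`), and regions
are boxes, so the push-forward is a mixture of products of the marginals `System.marginal`
(`System.transition_real_preimage_J`). Each marginal satisfies the interval bounds, because the mean
and the variance at `x` take part in the optimization that defines them, and because the end points
of a cell are null sets (`IsGaussianAbstraction.axisDistribution_mem`). Hence the push-forward
belongs to the ambiguity set, and its expectation lies between the pessimistic and the optimistic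
backup. The divide-and-conquer backups also bracket it, since the expectation over a product
distribution is an iterated expectation over the marginals (`sequentialOpt_expectation`) and every
optimization over a marginal brackets the corresponding expectation (`sequentialOpt_mono`).

*Comparison.* Abstract reach states lie in `R` and states that are not avoid states lie in `X \ O`,
which gives the lower bound by induction on the horizon (`valueIteration_le_reachAvoidValue`). If
`R` and `O` are unions of cells, every cell that meets one of them is contained in it, so that the
abstract labels are exact and the upper bound follows in the same way
(`reachAvoidValue_le_valueIteration`).
-/

open MeasureTheory ProbabilityTheory

/-! ### Dynamic programming for reach-avoid probabilities -/

namespace OdIMDP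

section ReachAvoid

variable {E : Type*}

/-- The trajectories that reach `R` at some time in `[j, j + k]` and stay in `A` from time `j` until
then. -/
def reachAvoidEvent (A R : Set E) (j k : ℕ) : Set (ℕ → E) :=
  {ω | ∃ i ≤ k, ω (j + i) ∈ R ∧ ∀ i' ≤ i, ω (j + i') ∈ A}

theorem mem_reachAvoidEvent_zero {A R : Set E} (hRA : R ⊆ A) {j : ℕ} {ω : ℕ → E} :
    ω ∈ reachAvoidEvent A R j 0 ↔ ω j ∈ R := by
  constructor
  · rintro ⟨i, hi, h, -⟩
    obtain rfl : i = 0 := by omega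
    exact h
  · refine fun h => ⟨0, le_rfl, h, fun i' hi' => ?_⟩
    obtain rfl : i' = 0 := by omega
    exact hRA h

theorem mem_reachAvoidEvent_of_mem {A R : Set E} (hRA : R ⊆ A) {j k : ℕ} {ω : ℕ → E}
    (h : ω j ∈ R) : ω ∈ reachAvoidEvent A R j k := by
  refine ⟨0, k.zero_le, h, fun i' hi' => ?_⟩
  obtain rfl : i' = 0 := by omega
  exact hRA h

theorem notMem_reachAvoidEvent {A R : Set E} {j k : ℕ} {ω : ℕ → E}
    (h : ω j ∉ A) : ω ∉ reachAvoidEvent A R j k := by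
  rintro ⟨i, -, -, h'⟩
  exact h (h' 0 i.zero_le)

theorem mem_reachAvoidEvent_succ {A R : Set E} {j k : ℕ} {ω : ℕ → E}
    (hA : ω j ∈ A) (hR : ω j ∉ R) :
    ω ∈ reachAvoidEvent A R j (k + 1) ↔ ω ∈ reachAvoidEvent A R (j + 1) k := by
  have e : ∀ i, j + 1 + i = j + (i + 1) := fun i => by omega
  constructor
  · rintro ⟨_ | i, hi, h, h'⟩
    · exact absurd h hR
    · refine ⟨i, by omega, e i ▸ h, fun i' hi' => ?_⟩
      rw [e]
      exact h' _ (by omega)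
  · rintro ⟨i, hi, h, h'⟩
    refine ⟨i + 1, by omega, e i ▸ h, ?_⟩
    rintro (_ | i') hi'
    · exact hA
    · rw [← e]
      exact h' _ (by omega)

variable [MeasurableSpace E]

theorem measurableSet_reachAvoidEvent {A R : Set E} (hA : MeasurableSet A) (hR : MeasurableSet R)
    (j k : ℕ) : MeasurableSet (reachAvoidEvent A R j k) := by
  unfold reachAvoidEvent
  measurability

open Classical in
/-- The probability, as a function of the state `x` at time `j`, that the Markov chain with
kernels `κ` reaches `R` within the next `k` steps without leaving `A` before, by backward
recursion. -/
noncomputable def reachAvoidValue (κ : ℕ → Kernel E E) (A R : Set E) : ℕ → ℕ → E → ENNReal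
  | 0, _, x => if x ∈ R then 1 else 0
  | k + 1, j, x => if x ∈ R then 1 else if x ∈ A then
      ∫⁻ y, reachAvoidValue κ A R k (j + 1) y ∂κ j x else 0

variable {κ : ℕ → Kernel E E} {A R : Set E}

theorem measurable_reachAvoidValue (hA : MeasurableSet A) (hR : MeasurableSet R) (k j : ℕ) :
    Measurable (reachAvoidValue κ A R k j) := by
  induction k generalizing j with
  | zero => exact Measurable.ite hR measurable_const measurable_const
  | succ k ih =>
    exact Measurable.ite hR measurable_const
      (Measurable.ite hA (ih (j + 1)).lintegral_kernel measurable_const)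

theorem reachAvoidValue_le_one [∀ j, IsMarkovKernel (κ j)] (k j : ℕ) (x : E) :
    reachAvoidValue κ A R k j x ≤ 1 := by
  induction k generalizing j x with
  | zero =>
    unfold reachAvoidValue
    split_ifs <;> simp
  | succ k ih =>
    unfold reachAvoidValue
    split_ifs
    · exact le_rfl
    · exact (lintegral_mono fun y => ih (j + 1) y).trans (by simp)
    · exact zero_le_one

/-- The Ionescu-Tulcea kernels of a Markov chain: the next state depends on the current one
only. -/
noncomputable def markovStep (κ : ℕ → Kernel E E) (k : ℕ) : Kernel (Finset.Iic k → E) E :=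
  (κ k).comap (fun h : (i : Finset.Iic k) → E => h ⟨k, Finset.mem_Iic.2 le_rfl⟩)
    (measurable_pi_apply _)

instance [∀ j, IsMarkovKernel (κ j)] (k : ℕ) : IsMarkovKernel (markovStep κ k) := by
  unfold markovStep
  infer_instance

/-- The trajectory measure started from a history is carried by the trajectories that extend this
history. -/
theorem ae_traj_eq_history [MeasurableSingletonClass E]
    (η : (k : ℕ) → Kernel (Finset.Iic k → E) E) [∀ k, IsMarkovKernel (η k)]
    (j : ℕ) (h : Finset.Iic j → E) :
    ∀ᵐ ω ∂(Kernel.traj (X := fun _ => E) η j h), ∀ i : Finset.Iic j, ω i = h i := by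
  have h1 := Kernel.traj_map_frestrictLe_apply (X := fun _ => E) (κ := η) j j h
  rw [Kernel.partialTraj_self, Kernel.id_apply] at h1
  have h2 : ∀ᵐ g ∂((Kernel.traj (X := fun _ => E) η j h).map (Preorder.frestrictLe j)),
      g = h := by
    rw [h1, ae_dirac_iff (p := fun g => g = h) (measurableSet_singleton h)]
  filter_upwards [ae_of_ae_map (by fun_prop) h2] with ω hω i
  exact congrFun hω i

/-- One step of the Markov property for the trajectory measure. -/
theorem traj_apply_eq_lintegral_succ
    (η : (k : ℕ) → Kernel (Finset.Iic k → E) E) [∀ k, IsMarkovKernel (η k)]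
    (j : ℕ) (h : Finset.Iic j → E) {B : Set (ℕ → E)} (hB : MeasurableSet B) :
    Kernel.traj (X := fun _ => E) η j h B = ∫⁻ ω, Kernel.traj (X := fun _ => E) η (j + 1)
      (Preorder.frestrictLe (π := fun _ => E) (j + 1) ω) B
        ∂(Kernel.traj (X := fun _ => E) η j h) := by
  conv_lhs => rw [← Kernel.traj_comp_partialTraj (X := fun _ => E) (κ := η) j.le_succ]
  rw [Kernel.comp_apply' _ _ _ hB, ← Kernel.traj_map_frestrictLe_apply, lintegral_map]
  · exact Kernel.measurable_coe _ hB
  · fun_prop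

/-- Dynamic programming: after any history, the conditional probability of the remaining
reach-avoid event is the value of the backward recursion at the current state. -/
theorem traj_reachAvoidEvent [MeasurableSingletonClass E] [∀ j, IsMarkovKernel (κ j)]
    (hA : MeasurableSet A) (hR : MeasurableSet R) (hRA : R ⊆ A) (k j : ℕ)
    (h : Finset.Iic j → E) :
    Kernel.traj (X := fun _ => E) (markovStep κ) j h (reachAvoidEvent A R j k) =
      reachAvoidValue κ A R k j (h ⟨j, Finset.mem_Iic.2 le_rfl⟩) := by
  induction k generalizing j with
  | zero =>
    have hae := ae_traj_eq_history (markovStep κ) j h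
    unfold reachAvoidValue
    split_ifs with hx
    · rw [← mem_ae_iff_prob_eq_one (measurableSet_reachAvoidEvent hA hR j 0)]
      filter_upwards [hae] with ω hω
      rw [mem_reachAvoidEvent_zero hRA]
      exact (hω ⟨j, Finset.mem_Iic.2 le_rfl⟩) ▸ hx
    · rw [measure_eq_zero_iff_ae_notMem]
      filter_upwards [hae] with ω hω
      rw [mem_reachAvoidEvent_zero hRA]
      exact (hω ⟨j, Finset.mem_Iic.2 le_rfl⟩) ▸ hx
  | succ k ih =>
    have hae := ae_traj_eq_history (markovStep κ) j h
    unfold reachAvoidValue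
    split_ifs with hx hxA
    · rw [← mem_ae_iff_prob_eq_one (measurableSet_reachAvoidEvent hA hR j _)]
      filter_upwards [hae] with ω hω
      apply mem_reachAvoidEvent_of_mem hRA
      exact (hω ⟨j, Finset.mem_Iic.2 le_rfl⟩) ▸ hx
    · have e1 : Kernel.traj (X := fun _ => E) (markovStep κ) j h (reachAvoidEvent A R j (k + 1))
          = Kernel.traj (X := fun _ => E) (markovStep κ) j h (reachAvoidEvent A R (j + 1) k) := by
        apply measure_congr
        filter_upwards [hae] with ω hω
        have e := hω ⟨j, Finset.mem_Iic.2 le_rfl⟩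
        exact propext (mem_reachAvoidEvent_succ (e ▸ hxA) (e ▸ hx))
      rw [e1, traj_apply_eq_lintegral_succ _ _ _ (measurableSet_reachAvoidEvent hA hR _ _)]
      simp only [ih]
      have e2 := Kernel.map_traj_succ_self (X := fun _ => E) (κ := markovStep κ) (a := j)
      have e3 : κ j (h ⟨j, Finset.mem_Iic.2 le_rfl⟩) = markovStep κ j h := rfl
      rw [e3, ← e2, Kernel.map_apply _ (by fun_prop),
        lintegral_map (measurable_reachAvoidValue hA hR k (j + 1)) (by fun_prop)]
      rfl
    · rw [measure_eq_zero_iff_ae_notMem]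
      filter_upwards [hae] with ω hω
      apply notMem_reachAvoidEvent
      exact (hω ⟨j, Finset.mem_Iic.2 le_rfl⟩) ▸ hxA

end ReachAvoid

/-! ### Comparison of value iteration with the reach-avoid probabilities -/

section Comparison

variable {E : Type*} [MeasurableSpace E] {S A : Type*} [Fintype S]

/-- The expectation of a function that factors through a finite abstraction `J`. -/
theorem integral_comp_eq_sum_fiber (μ : Measure E) [IsFiniteMeasure μ] {J : E → S}
    (hJ : ∀ s, MeasurableSet (J ⁻¹' {s})) (V : S → ℝ) :
    Integrable (fun y => V (J y)) μ ∧ ∫ y, V (J y) ∂μ = ∑ s, V s * μ.real (J ⁻¹' {s}) := by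
  let _ : MeasurableSpace S := ⊤
  have hJm : Measurable J := measurable_to_countable' hJ
  have hV : Measurable V := measurable_from_top
  constructor
  · exact ((Integrable.of_finite (μ := μ.map J) (f := V)).comp_measurable hJm)
  · rw [← integral_map (φ := J) hJm.aemeasurable hV.aestronglyMeasurable,
      integral_fintype (Integrable.of_finite)]
    refine Finset.sum_congr rfl fun s _ => ?_
    rw [map_measureReal_apply hJm (MeasurableSet.singleton s), smul_eq_mul, mul_comm]

variable {κ : ℕ → Kernel E E} [∀ j, IsMarkovKernel (κ j)] {D R : Set E} {J : E → S}
  {reach avoid : Set S} {B : S → A → (S → ℝ) → ℝ} {π : S → ℕ → A}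

theorem lintegral_reachAvoidValue_le_one (k j j' : ℕ) (x : E) :
    ∫⁻ y, reachAvoidValue κ D R k j y ∂κ j' x ≤ 1 :=
  (lintegral_mono fun y => reachAvoidValue_le_one k j y).trans (by simp)

theorem integral_toReal_reachAvoidValue (hD : MeasurableSet D) (hR : MeasurableSet R)
    (k j j' : ℕ) (x : E) :
    Integrable (fun y => (reachAvoidValue κ D R k j y).toReal) (κ j' x) ∧
      ∫ y, (reachAvoidValue κ D R k j y).toReal ∂κ j' x =
        (∫⁻ y, reachAvoidValue κ D R k j y ∂κ j' x).toReal := by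
  have hm := measurable_reachAvoidValue (κ := κ) hD hR k j
  constructor
  · exact integrable_toReal_of_lintegral_ne_top hm.aemeasurable
      ((lintegral_reachAvoidValue_le_one k j j' x).trans_lt ENNReal.one_lt_top).ne
  · exact integral_toReal hm.aemeasurable (.of_forall fun y =>
      (reachAvoidValue_le_one k j y).trans_lt ENNReal.one_lt_top)

/-- If the abstract backup underestimates the expectation of every abstract value function under
the concrete kernel, then value iteration underestimates the reach-avoid probabilities. -/
theorem valueIteration_le_reachAvoidValue (hD : MeasurableSet D) (hR : MeasurableSet R)
    (hJ : ∀ s, MeasurableSet (J ⁻¹' {s}))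
    (hreach : ∀ x, J x ∈ reach → x ∈ R) (havoid : ∀ x, J x ∉ avoid → x ∈ D)
    (hB : ∀ x j V, J x ∉ avoid →
      B (J x) (π (J x) j) V ≤ ∑ s, V s * (κ j x).real (J ⁻¹' {s}))
    (k j : ℕ) (x : E) :
    valueIteration reach avoid B k (fun s i => π s (j + i)) (J x) ≤
      (reachAvoidValue κ D R k j x).toReal := by
  induction k generalizing j x with
  | zero =>
    unfold valueIteration reachAvoidValue
    by_cases h : J x ∈ reach
    · simp [h, hreach x h]
    · simp [h]
  | succ k ih =>
    unfold valueIteration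
    by_cases h : J x ∈ reach
    · simp [h, reachAvoidValue, hreach x h]
    by_cases h' : J x ∈ avoid
    · simp [h, h']
    have hsh : (fun (s : S) (i : ℕ) => π s (j + (i + 1))) = fun s i => π s (j + 1 + i) := by
      funext s i
      rw [Nat.add_assoc, Nat.add_comm 1 i]
    have hq := lintegral_reachAvoidValue_le_one (κ := κ) (D := D) (R := R) k (j + 1) j x
    have key : B (J x) (π (J x) (j + 0))
        (valueIteration reach avoid B k fun s i => π s (j + (i + 1))) ≤
        (∫⁻ y, reachAvoidValue κ D R k (j + 1) y ∂κ j x).toReal := by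
      refine (hB x j _ h').trans ?_
      rw [hsh, ← (integral_comp_eq_sum_fiber _ hJ _).2,
        ← (integral_toReal_reachAvoidValue hD hR _ _ _ _).2]
      exact integral_mono (integral_comp_eq_sum_fiber _ hJ _).1
        (integral_toReal_reachAvoidValue hD hR _ _ _ _).1 fun y => ih (j + 1) y
    simp only [Set.indicator_of_notMem h, zero_add,
      Set.indicator_of_mem (show J x ∈ (reach ∪ avoid)ᶜ by simp [h, h']), Pi.one_apply, one_mul]
    refine key.trans ?_
    rw [reachAvoidValue]
    split_ifs with hxR hxD
    · exact ENNReal.toReal_mono ENNReal.one_ne_top hq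
    · exact le_rfl
    · exact absurd (havoid x h') hxD

/-- If the abstract backup overestimates the expectation of every abstract value function under
the concrete kernel, and the abstract reach and avoid states represent the concrete sets exactly,
then value iteration overestimates the reach-avoid probabilities. -/
theorem reachAvoidValue_le_valueIteration (hD : MeasurableSet D) (hR : MeasurableSet R)
    (hJ : ∀ s, MeasurableSet (J ⁻¹' {s}))
    (hreach : ∀ x ∈ R, J x ∈ reach) (havoid : ∀ x, J x ∈ avoid → x ∉ D)
    (hB : ∀ x j V, J x ∉ avoid →
      ∑ s, V s * (κ j x).real (J ⁻¹' {s}) ≤ B (J x) (π (J x) j) V)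
    (k j : ℕ) (x : E) :
    (reachAvoidValue κ D R k j x).toReal ≤
      valueIteration reach avoid B k (fun s i => π s (j + i)) (J x) := by
  induction k generalizing j x with
  | zero =>
    unfold valueIteration reachAvoidValue
    split_ifs with h
    · simp [hreach x h]
    · simpa using Set.indicator_nonneg (f := (1 : S → ℝ)) (fun _ _ => zero_le_one) (J x)
  | succ k ih =>
    unfold valueIteration
    by_cases h : J x ∈ reach
    · simpa [h] using ENNReal.toReal_mono ENNReal.one_ne_top
        (reachAvoidValue_le_one (κ := κ) (A := D) (R := R) (k + 1) j x)
    have hxR : x ∉ R := fun hx => h (hreach x hx)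
    by_cases h' : J x ∈ avoid
    · simp [h, h', reachAvoidValue, hxR, havoid x h']
    have hsh : (fun (s : S) (i : ℕ) => π s (j + (i + 1))) = fun s i => π s (j + 1 + i) := by
      funext s i
      rw [Nat.add_assoc, Nat.add_comm 1 i]
    have key : (∫⁻ y, reachAvoidValue κ D R k (j + 1) y ∂κ j x).toReal ≤
        B (J x) (π (J x) (j + 0))
          (valueIteration reach avoid B k fun s i => π s (j + (i + 1))) := by
      refine le_trans ?_ (hB x j _ h')
      rw [hsh, ← (integral_comp_eq_sum_fiber _ hJ _).2,
        ← (integral_toReal_reachAvoidValue hD hR _ _ _ _).2]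
      exact integral_mono (integral_toReal_reachAvoidValue hD hR _ _ _ _).1
        (integral_comp_eq_sum_fiber _ hJ _).1 fun y => ih (j + 1) y
    simp only [Set.indicator_of_notMem h, zero_add,
      Set.indicator_of_mem (show J x ∈ (reach ∪ avoid)ᶜ by simp [h, h']), Pi.one_apply, one_mul]
    refine le_trans ?_ key
    rw [reachAvoidValue]
    split_ifs
    · exact le_rfl
    · exact ENNReal.toReal_nonneg

end Comparison

end OdIMDP

/-! ### Optimization over ambiguity sets -/

namespace OdIMDP

section Ambiguity

variable {S : Type*} [Fintype S]

theorem minExp_le {Γ : Set (S → ℝ)} (hΓ : Γ ⊆ stdSimplex ℝ S) {γ : S → ℝ} (hγ : γ ∈ Γ)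
    (V : S → ℝ) : minExp Γ V ≤ ∑ t, V t * γ t :=
  csInf_le (((isCompact_stdSimplex ℝ S).image (by fun_prop)).bddBelow.mono (Set.image_mono hΓ))
    ⟨γ, hγ, rfl⟩

theorem le_maxExp {Γ : Set (S → ℝ)} (hΓ : Γ ⊆ stdSimplex ℝ S) {γ : S → ℝ} (hγ : γ ∈ Γ)
    (V : S → ℝ) : ∑ t, V t * γ t ≤ maxExp Γ V :=
  le_csSup (((isCompact_stdSimplex ℝ S).image (by fun_prop)).bddAbove.mono (Set.image_mono hΓ))
    ⟨γ, hγ, rfl⟩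

theorem IntervalBounds.set_subset_stdSimplex (b : IntervalBounds S) :
    b.set ⊆ stdSimplex ℝ S := fun _ h => h.1

end Ambiguity

section Sequential

variable {n : ℕ} {S : Fin n → Type*}

theorem sequentialOpt_mono {opt opt' : ∀ i, (S i → ℝ) → ℝ}
    (h : ∀ i W W', W ≤ W' → opt i W ≤ opt' i W') (V : (∀ i, S i) → ℝ) (t : ∀ i, S i) :
    sequentialOpt opt V t ≤ sequentialOpt opt' V t := by
  unfold sequentialOpt
  induction List.finRange n generalizing t with
  | nil => exact le_rfl
  | cons i l ih => exact h i _ _ fun u => ih _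

variable [∀ i, Fintype (S i)]

/-- Taking expectations over one marginal after another amounts to taking the expectation over
the product distribution. -/
theorem sequentialOpt_expectation (γ : ∀ i, S i → ℝ) (V : (∀ i, S i) → ℝ) (t : ∀ i, S i) :
    sequentialOpt (fun i W => ∑ u, W u * γ i u) V t = ∑ s, V s * ∏ i, γ i (s i) := by
  classical
  -- After the axes in `l` have been integrated out, the distribution is `γ i` on the axes in `l`
  -- and a point mass at `t i` on the other axes.
  have key : ∀ l : List (Fin n), l.Nodup → ∀ t : ∀ i, S i,
      l.foldr (fun i W t => ∑ u, W (Function.update t i u) * γ i u) V t =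
        ∑ s, V s * ∏ i, (if i ∈ l then γ i (s i) else if s i = t i then 1 else 0) := by
    intro l hl
    induction l with
    | nil =>
      intro t
      simp [Fintype.prod_boole, ← funext_iff]
    | cons i l ih =>
      intro t
      obtain ⟨hi, hl⟩ := List.nodup_cons.1 hl
      simp only [List.foldr_cons, ih hl, Finset.sum_mul]
      rw [Finset.sum_comm]
      refine Finset.sum_congr rfl fun s _ => ?_
      have hrest : ∀ u, ∏ j ∈ Finset.univ.erase i, (if j ∈ l then γ j (s j) else
            if s j = Function.update t i u j then 1 else 0) =
          ∏ j ∈ Finset.univ.erase i, (if j ∈ i :: l then γ j (s j) else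
            if s j = t j then 1 else 0) := fun u =>
        Finset.prod_congr rfl fun j hj => by simp [Finset.ne_of_mem_erase hj]
      simp only [← Finset.mul_prod_erase _ _ (Finset.mem_univ i), hrest]
      simp [hi, mul_comm, mul_left_comm]
  have := key (List.finRange n) (List.nodup_finRange n) t
  simpa [sequentialOpt] using this

theorem stdSimplex_prod_mem {γ : ∀ i, S i → ℝ} (h : ∀ i, γ i ∈ stdSimplex ℝ (S i)) :
    (fun s : ∀ i, S i => ∏ i, γ i (s i)) ∈ stdSimplex ℝ (∀ i, S i) := by
  refine ⟨fun s => Finset.prod_nonneg fun i _ => (h i).1 _, ?_⟩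
  rw [← Fintype.piFinset_univ, ← Finset.prod_univ_sum]
  simp [(h _).2]

end Sequential

namespace ODIMDP

variable {n : ℕ} {S : Fin n → Type*} [∀ i, Fintype (S i)] {A : Type*} (M : ODIMDP S A)
  {s : ∀ i, S i} {a : A} {γ : ∀ i, S i → ℝ}

theorem ambiguity_subset_stdSimplex : M.ambiguity s a ⊆ stdSimplex ℝ (∀ i, S i) :=
  fun _ h => h.1

variable (hγ : ∀ i, γ i ∈ (M.bounds s a i).set)
include hγ

theorem prod_mem_ambiguity : (fun t => ∏ i, γ i (t i)) ∈ M.ambiguity s a :=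
  ⟨stdSimplex_prod_mem fun i => (hγ i).1, γ, hγ, fun _ => rfl⟩

theorem seqMin_le (V : (∀ i, S i) → ℝ) : M.seqMin s a V ≤ ∑ t, V t * ∏ i, γ i (t i) := by
  rw [← sequentialOpt_expectation γ V s]
  refine sequentialOpt_mono (fun i W W' h => ?_) V s
  exact (minExp_le (IntervalBounds.set_subset_stdSimplex _) (hγ i) W).trans
    (Finset.sum_le_sum fun u _ => mul_le_mul_of_nonneg_right (h u) ((hγ i).1.1 u))

theorem le_seqMax (V : (∀ i, S i) → ℝ) : ∑ t, V t * ∏ i, γ i (t i) ≤ M.seqMax s a V := by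
  rw [← sequentialOpt_expectation γ V s]
  refine sequentialOpt_mono (fun i W W' h => ?_) V s
  exact (Finset.sum_le_sum fun u _ => mul_le_mul_of_nonneg_right (h u) ((hγ i).1.1 u)).trans
    (le_maxExp (IntervalBounds.set_subset_stdSimplex _) (hγ i) W')

end ODIMDP

namespace MixtureODIMDP

variable {K n : ℕ} {S : Fin n → Type*} [∀ i, Fintype (S i)] {A : Type*} (M : MixtureODIMDP K S A)
  {s : ∀ i, S i} {a : A} {α : Fin K → ℝ} {γ : Fin K → ∀ i, S i → ℝ}

theorem ambiguity_subset_stdSimplex : M.ambiguity s a ⊆ stdSimplex ℝ (∀ i, S i) := by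
  rintro γ ⟨α, hα, γc, hγc, h⟩
  obtain rfl : γ = ∑ r, α r • γc r := by
    funext t
    simp [h, Finset.sum_apply]
  exact (convex_stdSimplex ℝ _).sum_mem (fun r _ => hα.1.1 r) hα.1.2 fun r _ => (hγc r).1

theorem sum_mul_mixture (V : (∀ i, S i) → ℝ) :
    ∑ t, V t * ∑ r, α r * ∏ i, γ r i (t i) =
      ∑ r, (∑ t, V t * ∏ i, γ r i (t i)) * α r := by
  simp only [Finset.mul_sum, Finset.sum_mul]
  rw [Finset.sum_comm]
  exact Finset.sum_congr rfl fun r _ => Finset.sum_congr rfl fun t _ => by ring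

variable (hα : α ∈ (M.weightBounds s a).set)
  (hγ : ∀ r i, γ r i ∈ ((M.component r).bounds s a i).set)
include hα hγ

theorem mixture_mem_ambiguity :
    (fun t => ∑ r, α r * ∏ i, γ r i (t i)) ∈ M.ambiguity s a :=
  ⟨α, hα, _, fun r => (M.component r).prod_mem_ambiguity (hγ r), fun _ => rfl⟩

theorem minExp_seqMin_le (V : (∀ i, S i) → ℝ) :
    minExp (M.weightBounds s a).set (fun r => (M.component r).seqMin s a V) ≤
      ∑ t, V t * ∑ r, α r * ∏ i, γ r i (t i) := by
  rw [sum_mul_mixture]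
  exact (minExp_le (IntervalBounds.set_subset_stdSimplex _) hα _).trans
    (Finset.sum_le_sum fun r _ => mul_le_mul_of_nonneg_right
      ((M.component r).seqMin_le (hγ r) V) (hα.1.1 r))

theorem le_maxExp_seqMax (V : (∀ i, S i) → ℝ) :
    ∑ t, V t * ∑ r, α r * ∏ i, γ r i (t i) ≤
      maxExp (M.weightBounds s a).set (fun r => (M.component r).seqMax s a V) := by
  rw [sum_mul_mixture]
  exact (Finset.sum_le_sum fun r _ => mul_le_mul_of_nonneg_right
      ((M.component r).le_seqMax (hγ r) V) (hα.1.1 r)).trans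
    (le_maxExp (IntervalBounds.set_subset_stdSimplex _) hα _)

end MixtureODIMDP

end OdIMDP

/-! ### Gaussian probabilities of grid regions -/

namespace OdIMDP

theorem gaussianMeasure_eq_pi {n : ℕ} (m : Fin n → ℝ) {S : Matrix (Fin n) (Fin n) ℝ}
    (hS : S.PosDef) (hd : S.IsDiag) :
    gaussianMeasure m S = Measure.pi fun i => gaussianReal (m i) (S i i).toNNReal := by
  have hpos : ∀ i, (S i i).toNNReal ≠ 0 := fun i => by
    simpa using (hS.diag_pos (i := i))
  refine (Measure.pi_eq fun B hB => ?_).symm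
  have hint : Integrable (fun y : Fin n → ℝ => ∏ i, gaussianPDFReal (m i) (S i i).toNNReal (y i))
      (Measure.pi fun i => volume.restrict (B i)) :=
    Integrable.fintype_prod fun i => (integrable_gaussianPDFReal _ _).restrict
  unfold gaussianMeasure
  simp only [gaussianDensity_eq_prod m hS hd]
  rw [withDensity_apply _ (MeasurableSet.univ_pi hB), volume_pi, Measure.restrict_pi_pi,
    ← ofReal_integral_eq_lintegral_ofReal hint
      (Filter.Eventually.of_forall fun y =>
        Finset.prod_nonneg fun i _ => gaussianPDFReal_nonneg _ _ _),
    integral_fintype_prod_eq_prod, ENNReal.ofReal_prod_of_nonneg fun i _ =>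
      integral_nonneg fun y => gaussianPDFReal_nonneg _ _ _]
  exact Finset.prod_congr rfl fun i _ => (gaussianReal_apply_eq_integral _ (hpos i) _).symm

namespace Grid

variable {n : ℕ} (G : Grid n)

theorem measurableSet_axisRegion (i : Fin n) (s : G.AxisState i) :
    MeasurableSet (G.axisRegion i s) := by
  cases s with
  | none => exact measurableSet_Icc.compl
  | some c =>
    refine Set.OrdConnected.measurableSet ⟨fun a ha b hb y hy => ?_⟩
    rcases eq_or_lt_of_le hy.1 with rfl | h1
    · exact ha
    rcases eq_or_lt_of_le hy.2 with rfl | h2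
    · exact hb
    exact G.Ioo_subset_cell i c ⟨(G.cell_subset_Icc i c ha).1.trans_lt h1,
      h2.trans_le (G.cell_subset_Icc i c hb).2⟩

/-- The distribution that a measure on the real line induces on the abstract states of an axis. -/
noncomputable def axisDistribution (i : Fin n) (μ : Measure ℝ) (s : G.AxisState i) : ℝ :=
  μ.real (G.axisRegion i s)

theorem axisDistribution_mem_stdSimplex (i : Fin n) (μ : Measure ℝ) [IsProbabilityMeasure μ] :
    G.axisDistribution i μ ∈ stdSimplex ℝ (G.AxisState i) := by
  refine ⟨fun s => measureReal_nonneg, ?_⟩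
  have hU : ⋃ s, G.axisRegion i s = Set.univ :=
    Set.eq_univ_of_forall fun y => Set.mem_iUnion.2 (G.exists_unique_axisState i y).exists
  have hd : Pairwise (Function.onFun Disjoint (G.axisRegion i)) := fun s t hst =>
    Set.disjoint_left.2 fun y hs ht => hst ((G.exists_unique_axisState i y).unique hs ht)
  simp only [axisDistribution]
  rw [← measureReal_iUnion_fintype hd (G.measurableSet_axisRegion i), hU, probReal_univ]

theorem axisDistribution_some (i : Fin n) (μ : Measure ℝ) [NullSingletonClass μ] (c : Fin (G.N i)) :
    G.axisDistribution i μ (some c) = μ.real (Set.Icc (G.left i c) (G.right i c)) := by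
  have h1 : μ (G.cell i c) ≤ μ (Set.Icc (G.left i c) (G.right i c)) :=
    measure_mono (G.cell_subset_Icc i c)
  have h2 : μ (Set.Icc (G.left i c) (G.right i c)) ≤ μ (G.cell i c) := by
    rw [← measure_congr (Ioo_ae_eq_Icc (μ := μ))]
    exact measure_mono (G.Ioo_subset_cell i c)
  exact congrArg ENNReal.toReal (h1.antisymm h2)

theorem axisDistribution_none (i : Fin n) (μ : Measure ℝ) [IsProbabilityMeasure μ] :
    G.axisDistribution i μ none = 1 - μ.real (Set.Icc (G.lo i) (G.up i)) :=
  probReal_compl_eq_one_sub measurableSet_Icc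

theorem preimage_J (s : G.State) :
    G.J ⁻¹' {s} = Set.univ.pi fun i => G.axisRegion i (s i) := by
  ext x
  simp [G.J_eq_iff, region]

theorem measurableSet_preimage_J (s : G.State) : MeasurableSet (G.J ⁻¹' {s}) := by
  rw [preimage_J]
  exact MeasurableSet.univ_pi fun i => G.measurableSet_axisRegion i (s i)

theorem exists_J_eq_cellState {O : Set (Fin n → ℝ)} {x : Fin n → ℝ} (h : G.J x ∉ G.avoidStates O) :
    ∃ c, G.J x = G.cellState c ∧ x ∈ G.region (G.cellState c) := by
  have h' : ∀ i, ∃ c, G.J x i = some c := fun i =>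
    Option.ne_none_iff_exists'.1 fun e => h (Or.inl ⟨i, e⟩)
  choose c hc using h'
  have e : G.J x = G.cellState c := funext hc
  exact ⟨c, e, (G.J_eq_iff x _).1 e⟩

theorem region_cellState_subset_domain (c : ∀ i, Fin (G.N i)) :
    G.region (G.cellState c) ⊆ G.domain := fun _ hx i =>
  G.iUnion_cell i ▸ Set.mem_iUnion.2 ⟨c i, hx i⟩

theorem mem_of_J_mem_reachStates {R : Set (Fin n → ℝ)} {x : Fin n → ℝ}
    (h : G.J x ∈ G.reachStates R) : x ∈ R :=
  h.2 ((G.J_eq_iff x _).1 rfl)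

theorem mem_diff_of_J_notMem_avoidStates {O : Set (Fin n → ℝ)} {x : Fin n → ℝ}
    (h : G.J x ∉ G.avoidStates O) : x ∈ G.domain \ O := by
  obtain ⟨c, -, hx⟩ := G.exists_J_eq_cellState h
  exact ⟨G.region_cellState_subset_domain c hx,
    fun hO => h (Or.inr ⟨x, (G.J_eq_iff x _).1 rfl, hO⟩)⟩

theorem Aligned.region_subset {G : Grid n} {B : Set (Fin n → ℝ)} (hB : G.Aligned B)
    {x : Fin n → ℝ} (hx : x ∈ B) : G.region (G.J x) ⊆ B := by
  obtain ⟨C, rfl⟩ := hB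
  obtain ⟨c, hc, hxc⟩ := Set.mem_iUnion₂.1 hx
  rw [(G.J_eq_iff x _).2 hxc]
  exact Set.subset_biUnion_of_mem (u := fun c => G.region (G.cellState c)) hc

theorem Aligned.J_mem_reachStates {G : Grid n} {R : Set (Fin n → ℝ)} (hR : G.Aligned R)
    {x : Fin n → ℝ} (hx : x ∈ R) : G.J x ∈ G.reachStates R := by
  refine ⟨fun i => ?_, hR.region_subset hx⟩
  obtain ⟨C, rfl⟩ := hR
  obtain ⟨c, -, hxc⟩ := Set.mem_iUnion₂.1 hx
  rw [(G.J_eq_iff x _).2 hxc]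
  exact Option.some_ne_none _

theorem Aligned.notMem_diff {G : Grid n} {O : Set (Fin n → ℝ)} (hO : G.Aligned O)
    {x : Fin n → ℝ} (hx : G.J x ∈ G.avoidStates O) : x ∉ G.domain \ O := by
  have hxJ : x ∈ G.region (G.J x) := (G.J_eq_iff x _).1 rfl
  rintro ⟨hxD, hxO⟩
  obtain ⟨i, hi⟩ | ⟨y, hy, hyO⟩ := hx
  · have := hxJ i
    rw [hi] at this
    exact this (hxD i)
  · have := hO.region_subset hyO
    rw [(G.J_eq_iff y _).2 hy] at this
    exact hxO (this hxJ)

theorem measurableSet_domain : MeasurableSet G.domain := by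
  have : G.domain = Set.univ.pi fun i => Set.Icc (G.lo i) (G.up i) := by
    ext x
    simp only [domain, Set.mem_univ_pi, Set.mem_ofPred_eq]
  rw [this]
  exact MeasurableSet.univ_pi fun i => measurableSet_Icc

end Grid

/-- The marginals of the concrete one-step distribution are feasible for the abstraction. -/
theorem IsGaussianAbstraction.axisDistribution_mem {n : ℕ} {U : Type*} {G : Grid n}
    {mean : (Fin n → ℝ) → U → (Fin n → ℝ)}
    {cov : (Fin n → ℝ) → U → Matrix (Fin n) (Fin n) ℝ} {M : ODIMDP G.AxisState U}
    (h : IsGaussianAbstraction G mean cov M) {c : ∀ i, Fin (G.N i)} {x : Fin n → ℝ}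
    (hx : x ∈ G.region (G.cellState c)) (a : U) (i : Fin n) :
    G.axisDistribution i (gaussianReal (mean x a i) (cov x a i i).toNNReal) ∈
      (M.bounds (G.cellState c) a i).set := by
  obtain ⟨mlo, mup, vlo, vup, hvlo, hmv, hcell, hlow, hupp⟩ := h.cell_bounds c a i
  obtain ⟨hm, hv⟩ := hmv x hx
  have hpos : (cov x a i i).toNNReal ≠ 0 := by simpa using hvlo.trans_le hv.1
  have := nullSingletonClass_gaussianReal (μ := mean x a i) hpos
  have hmem : ∀ p q, (gaussianReal (mean x a i) (cov x a i i).toNNReal).real (Set.Icc p q) ∈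
      intervalProbs mlo mup vlo vup p q := fun p q => ⟨_, hm, _, hv, rfl⟩
  refine ⟨G.axisDistribution_mem_stdSimplex i _, ?_⟩
  rintro (_ | t)
  · rw [G.axisDistribution_none]
    have h1 := hlow.2 (hmem _ _)
    have h2 := hupp.2 (hmem _ _)
    constructor <;> linarith
  · rw [G.axisDistribution_some]
    exact ⟨(hcell t).1.2 (hmem _ _), (hcell t).2.2 (hmem _ _)⟩

namespace System

variable {n K : ℕ} {U : Type*} (T : System n K U) (G : Grid n)

/-- The marginal on axis `i` of the `r`-th component of the one-step distribution. -/
noncomputable def marginal (x : Fin n → ℝ) (u : U) (r : Fin K) (i : Fin n) : G.AxisState i → ℝ :=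
  G.axisDistribution i (gaussianReal (T.mean r x u i) (T.cov r x u i i).toNNReal)

theorem transition_real_preimage_J (x : Fin n → ℝ) (u : U) (s : G.State) :
    (T.transition x u).real (G.J ⁻¹' {s}) =
      ∑ r, T.weight r x u * ∏ i, T.marginal G x u r i (s i) := by
  have hpi : ∀ r, gaussianMeasure (T.mean r x u) (T.cov r x u) (G.J ⁻¹' {s}) =
      ∏ i, gaussianReal (T.mean r x u i) (T.cov r x u i i).toNNReal (G.axisRegion i (s i)) := by
    intro r
    rw [gaussianMeasure_eq_pi _ (T.cov_posDef r x u) (T.cov_isDiag r x u), G.preimage_J,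
      Measure.pi_pi]
  simp only [measureReal_def, transition, Measure.coe_finsetSum, Finset.sum_apply,
    Measure.smul_apply, smul_eq_mul, hpi]
  rw [ENNReal.toReal_sum fun r _ => ENNReal.mul_ne_top ENNReal.ofReal_ne_top
    (ENNReal.prod_ne_top fun i _ => measure_ne_top _ _)]
  refine Finset.sum_congr rfl fun r _ => ?_
  rw [ENNReal.toReal_mul, ENNReal.toReal_ofReal (T.weight_nonneg r x u), ENNReal.toReal_prod]
  rfl

variable [Finite U] {R O : Set (Fin n → ℝ)}

theorem reachAvoidProb_eq_reachAvoidValue (hR : IsClosed R) (hO : IsClosed O)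
    (hRX : R ⊆ G.domain) (hRO : R ∩ O = ∅) (x₀ : Fin n → ℝ) (π : Policy n U) (H : ℕ) :
    T.reachAvoidProb G.domain R O x₀ π H =
      (reachAvoidValue (T.closedLoop π) (G.domain \ O) R H 0 x₀).toReal := by
  have hRD : R ⊆ G.domain \ O := fun x hx => ⟨hRX hx, fun h => (hRO ▸ ⟨hx, h⟩ : x ∈ (∅ : Set _))⟩
  have := traj_reachAvoidEvent (κ := T.closedLoop π)
    (G.measurableSet_domain.diff hO.measurableSet) hR.measurableSet hRD H 0 fun _ => x₀
  rw [← this]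
  have e : {ω : ℕ → Fin n → ℝ | ∃ k ≤ H, ω k ∈ R ∧ ∀ k' ≤ k, ω k' ∉ O ∧ ω k' ∈ G.domain} =
      reachAvoidEvent (G.domain \ O) R 0 H := by
    ext ω
    simp only [reachAvoidEvent, Set.mem_ofPred_eq, Nat.zero_add, Set.mem_sdiff,
      and_comm (a := _ ∉ O)]
  rw [reachAvoidProb, e]
  rfl

/-- A backup that underestimates the expectations under the concrete kernel on the grid cells
gives a sound lower bound. -/
theorem valueIteration_le_reachAvoidProb (hR : IsClosed R) (hO : IsClosed O)
    (hRX : R ⊆ G.domain) (hRO : R ∩ O = ∅) {B : G.State → U → (G.State → ℝ) → ℝ}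
    (hB : ∀ (c : ∀ i, Fin (G.N i)) (u : U) (V : G.State → ℝ), ∀ x ∈ G.region (G.cellState c),
      B (G.cellState c) u V ≤
        ∑ s, V s * ∑ r, T.weight r x u * ∏ i, T.marginal G x u r i (s i))
    (π : G.State → ℕ → U) (H : ℕ) (x₀ : Fin n → ℝ) :
    valueIteration (G.reachStates R) (G.avoidStates O) B H π (G.J x₀) ≤
      T.reachAvoidProb G.domain R O x₀ (G.inducedPolicy π) H := by
  rw [reachAvoidProb_eq_reachAvoidValue T G hR hO hRX hRO]
  have := valueIteration_le_reachAvoidValue (κ := T.closedLoop (G.inducedPolicy π)) (π := π)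
    (B := B) (G.measurableSet_domain.diff hO.measurableSet) hR.measurableSet
    G.measurableSet_preimage_J (fun x => G.mem_of_J_mem_reachStates)
    (fun x => G.mem_diff_of_J_notMem_avoidStates (O := O)) (fun x j V hx => ?_) H 0 x₀
  · simpa only [Nat.zero_add] using this
  · obtain ⟨c, e, hc⟩ := G.exists_J_eq_cellState hx
    have := hB c (π (G.J x) j) V x hc
    simp only [← transition_real_preimage_J, ← e] at this
    exact this

/-- A backup that overestimates the expectations under the concrete kernel on the grid cells
gives a sound upper bound for aligned sets. -/
theorem reachAvoidProb_le_valueIteration (hR : IsClosed R) (hO : IsClosed O)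
    (hRX : R ⊆ G.domain) (hRO : R ∩ O = ∅) (hRG : G.Aligned R) (hOG : G.Aligned O)
    {B : G.State → U → (G.State → ℝ) → ℝ}
    (hB : ∀ (c : ∀ i, Fin (G.N i)) (u : U) (V : G.State → ℝ), ∀ x ∈ G.region (G.cellState c),
      ∑ s, V s * ∑ r, T.weight r x u * ∏ i, T.marginal G x u r i (s i) ≤
        B (G.cellState c) u V)
    (π : G.State → ℕ → U) (H : ℕ) (x₀ : Fin n → ℝ) :
    T.reachAvoidProb G.domain R O x₀ (G.inducedPolicy π) H ≤
      valueIteration (G.reachStates R) (G.avoidStates O) B H π (G.J x₀) := by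
  rw [reachAvoidProb_eq_reachAvoidValue T G hR hO hRX hRO]
  have := reachAvoidValue_le_valueIteration (κ := T.closedLoop (G.inducedPolicy π)) (π := π)
    (B := B) (G.measurableSet_domain.diff hO.measurableSet) hR.measurableSet
    G.measurableSet_preimage_J (fun x => hRG.J_mem_reachStates)
    (fun x => hOG.notMem_diff) (fun x j V hx => ?_) H 0 x₀
  · simpa only [Nat.zero_add] using this
  · obtain ⟨c, e, hc⟩ := G.exists_J_eq_cellState hx
    have := hB c (π (G.J x) j) V x hc
    simp only [← transition_real_preimage_J, ← e] at this
    exact this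

end System

end OdIMDP

/-! ### Soundness of the abstraction -/

theorem mainTheorem4 {n : ℕ} {U : Type*} [Finite U] (G : OdIMDP.Grid n)
    (R O : Set (Fin n → ℝ)) (hR : IsClosed R) (hO : IsClosed O)
    (hRX : R ⊆ G.domain) (hOX : O ⊆ G.domain) (hRO : R ∩ O = ∅)
    (π : G.State → ℕ → U) (x₀ : Fin n → ℝ) (hx₀ : x₀ ∈ G.domain) (H : ℕ) :
    -- Gaussian systems and odIMDP abstractions
    (∀ (T : OdIMDP.System n 1 U) (M : OdIMDP.ODIMDP G.AxisState U),
      OdIMDP.IsGaussianAbstraction G (T.mean 0) (T.cov 0) M →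
      let P := T.reachAvoidProb G.domain R O x₀ (G.inducedPolicy π) H
      (M.lowerValue (G.reachStates R) (G.avoidStates O) π H (G.J x₀) ≤ P ∧
        M.lowerValueDC (G.reachStates R) (G.avoidStates O) π H (G.J x₀) ≤ P) ∧
      (G.Aligned R → G.Aligned O →
        P ≤ M.upperValue (G.reachStates R) (G.avoidStates O) π H (G.J x₀) ∧
        P ≤ M.upperValueDC (G.reachStates R) (G.avoidStates O) π H (G.J x₀))) ∧
    -- Gaussian mixture systems and abstractions to mixtures of odIMDPs
    (∀ (K : ℕ) (T : OdIMDP.System n K U) (M : OdIMDP.MixtureODIMDP K G.AxisState U),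
      OdIMDP.IsMixtureAbstraction G T M →
      let P := T.reachAvoidProb G.domain R O x₀ (G.inducedPolicy π) H
      (M.lowerValue (G.reachStates R) (G.avoidStates O) π H (G.J x₀) ≤ P ∧
        M.lowerValueDC (G.reachStates R) (G.avoidStates O) π H (G.J x₀) ≤ P) ∧
      (G.Aligned R → G.Aligned O →
        P ≤ M.upperValue (G.reachStates R) (G.avoidStates O) π H (G.J x₀) ∧
        P ≤ M.upperValueDC (G.reachStates R) (G.avoidStates O) π H (G.J x₀))) := by
  constructor
  · intro T M hM
    have hw : ∀ x u, T.weight 0 x u = 1 := fun x u => by simpa using T.weight_sum x u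
    have hγ : ∀ {c x}, x ∈ G.region (G.cellState c) → ∀ u i,
        T.marginal G x u 0 i ∈ (M.bounds (G.cellState c) u i).set :=
      fun hx u i => hM.axisDistribution_mem hx u i
    refine ⟨⟨?_, ?_⟩, fun hRG hOG => ⟨?_, ?_⟩⟩
    · refine T.valueIteration_le_reachAvoidProb G hR hO hRX hRO (fun c u V x hx => ?_) π H x₀
      simpa [hw] using OdIMDP.minExp_le M.ambiguity_subset_stdSimplex (M.prod_mem_ambiguity (hγ hx u)) V
    · refine T.valueIteration_le_reachAvoidProb G hR hO hRX hRO (fun c u V x hx => ?_) π H x₀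
      simpa [hw] using M.seqMin_le (hγ hx u) V
    · refine T.reachAvoidProb_le_valueIteration G hR hO hRX hRO hRG hOG
        (fun c u V x hx => ?_) π H x₀
      simpa [hw] using OdIMDP.le_maxExp M.ambiguity_subset_stdSimplex (M.prod_mem_ambiguity (hγ hx u)) V
    · refine T.reachAvoidProb_le_valueIteration G hR hO hRX hRO hRG hOG
        (fun c u V x hx => ?_) π H x₀
      simpa [hw] using M.le_seqMax (hγ hx u) V
  · intro K T M hM
    have hγ : ∀ {c x}, x ∈ G.region (G.cellState c) → ∀ u r i,
        T.marginal G x u r i ∈ ((M.component r).bounds (G.cellState c) u i).set :=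
      fun hx u r i => (hM.component r).axisDistribution_mem hx u i
    refine ⟨⟨?_, ?_⟩, fun hRG hOG => ⟨?_, ?_⟩⟩
    · exact T.valueIteration_le_reachAvoidProb G hR hO hRX hRO (fun c u V x hx =>
        OdIMDP.minExp_le M.ambiguity_subset_stdSimplex
          (M.mixture_mem_ambiguity (hM.weights c u x hx) (hγ hx u)) V) π H x₀
    · exact T.valueIteration_le_reachAvoidProb G hR hO hRX hRO (fun c u V x hx =>
        M.minExp_seqMin_le (hM.weights c u x hx) (hγ hx u) V) π H x₀
    · exact T.reachAvoidProb_le_valueIteration G hR hO hRX hRO hRG hOG (fun c u V x hx =>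
        OdIMDP.le_maxExp M.ambiguity_subset_stdSimplex
          (M.mixture_mem_ambiguity (hM.weights c u x hx) (hγ hx u)) V) π H x₀
    · exact T.reachAvoidProb_le_valueIteration G hR hO hRX hRO hRG hOG (fun c u V x hx =>
        M.le_maxExp_seqMax (hM.weights c u x hx) (hγ hx u) V) π H x₀
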